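/- **Theorem (Bias).** Let $\{V_t,\ t=1,\dots,T\}$ be a real-valued random process, let $V^*\in\mathbb R$ and $\delta\in(0,1]$, and put $P_t=P(V_t\ge V^*)$. Let $V^{(1)},\dots,V^{(N)}$ be $N$ training runs, i.e. processes on a common probability space such that, for each fixed $t$, the variables $V_t^{(1)},\dots,V_t^{(N)}$ are independent and distributed as $V_t$. Put $$\hat P_t=\frac1N\sum_{i=1}^N\mathbb I\big[V_t^{(i)}\ge V^*\big],\qquad S=\sum_{t=1}^T\mathbb I[P_t<\delta],\qquad \hat S=\sum_{t=1}^T\mathbb I[\hat P_t<\delta],$$ $$b_t=\mathbb E\,\mathbb I[\hat P_t<\delta]-\mathbb I[P_t<\delta],$$ and let $\Phi(z)=\frac1{\sqrt{2\pi}}\int_{-\infty}^z e^{-x^2/2}\,dx$. 1. $P(\mathbb I[\hat P_t<\delta]=1)=P(\hat P_t<\delta)$ for all $t$, and $\mathbb E\hat S-S=\sum_{t=1}^T b_t$. 2. (Normal approximation, uniform.) For every $\epsilon>0$ there is $K>0$, depending only on $\epsilon$, such that, with $\Delta=\delta-P_t$ and $\sigma=\sqrt{P_t(1-P_t)}$,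 $$\big|P(\mathbb I[\hat P_t<\delta]=1)-\Phi(\Delta\sqrt N/\sigma)\big|\le\epsilon\qquad\text{whenever } N\,P_t(1-P_t)\ge K,$$ for all $\delta\in(0,1]$, all $t$, all $V^*$ and all processes and runs as above. In particular, for fixed $P_t\in(0,1)$ the difference tends to $0$ as $N\to\infty$, uniformly in $\delta\in(0,1]$. 3. (The bias is confined to a window around $P_t=\delta$.) For every $\epsilon>0$ there are $c,K>0$, depending only on $\epsilon$, such that for all $\delta\in(0,1)$ and $N$ with $N\delta(1-\delta)\ge K$, and for all $t$, $V^*$, processes and runs as above: if $|P_t-\delta|\ge c\sqrt{\delta(1-\delta)/N}$, then $|b_t|\le\epsilon$. 4. (The window has this width.) For every $c>0$ there are $\eta,K>0$, depending only on $c$, such that for all $\delta\in(0,1)$ and $N$ with $N\delta(1-\delta)\ge K$, and for all $t$, $V^*$, processes and runs as above: if $|P_t-\delta|\le c\sqrt{\delta(1-\delta)/N}$, then $|b_t|\ge\eta$. -/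

import Mathlib

open MeasureTheory ProbabilityTheory

universe u v

namespace SampleComplexity

open Classical in
/-- The indicator `𝕀[p]`: one if `p` holds and zero otherwise. -/
noncomputable def ind (p : Prop) : ℝ := if p then 1 else 0

/-- The distribution function `Φ` of the standard normal distribution. -/
noncomputable def Phi (x : ℝ) : ℝ := cdf (gaussianReal 0 1) x

/-- `P_t = P(V_t ≥ V*)` for one random variable `X = V_t`. -/
noncomputable def exceedProb {Ω : Type*} [MeasurableSpace Ω] (P : Measure Ω)
    (X : Ω → ℝ) (Vstar : ℝ) : ℝ :=
  P.real {ω | X ω ≥ Vstar}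

/-- The estimator `P̂_t = (1/N) ∑ i, 𝕀[V_t^(i) ≥ V*]`, where `V i` is the value of the `i`-th run
at the time considered. -/
noncomputable def empProb {Ω : Type*} {N : ℕ} (V : Fin N → Ω → ℝ) (Vstar : ℝ) (ω : Ω) : ℝ :=
  (1 / (N : ℝ)) * ∑ i, ind (V i ω ≥ Vstar)

/-- The sample complexity `S = ∑ t, 𝕀[P_t < δ]` of a process `X` with `T` time steps. -/
noncomputable def sampleComplexity {Ω : Type*} [MeasurableSpace Ω] {T : ℕ} (P : Measure Ω)
    (X : Fin T → Ω → ℝ) (Vstar δ : ℝ) : ℝ :=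
  ∑ t, ind (exceedProb P (X t) Vstar < δ)

/-- The empirical sample complexity `Ŝ = ∑ t, 𝕀[P̂_t < δ]` of `N` training runs. -/
noncomputable def empSampleComplexity {Ω : Type*} {N T : ℕ} (V : Fin N → Fin T → Ω → ℝ)
    (Vstar δ : ℝ) (ω : Ω) : ℝ :=
  ∑ t, ind (empProb (fun i => V i t) Vstar ω < δ)

/-- `V` consists of `N` training runs of the process `X`: for each fixed time `t`, the values
`V i t` are independent and distributed as `X t`. Nothing is assumed across different times. -/
structure IsIIDRuns {Ω₀ Ω : Type*} [MeasurableSpace Ω₀] [MeasurableSpace Ω] {N T : ℕ}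
    (P₀ : Measure Ω₀) (X : Fin T → Ω₀ → ℝ) (P : Measure Ω) (V : Fin N → Fin T → Ω → ℝ) :
    Prop where
  indep : ∀ t, iIndepFun (fun i => V i t) P
  identDistrib : ∀ t i, IdentDistrib (V i t) (X t) P P₀

/-- The bias `E 𝕀[P̂_t < δ] - 𝕀[P_t < δ]` of the indicator at time `t`. -/
noncomputable def biasAt {Ω₀ Ω : Type*} [MeasurableSpace Ω₀] [MeasurableSpace Ω] {N T : ℕ}
    (P₀ : Measure Ω₀) (X : Fin T → Ω₀ → ℝ) (P : Measure Ω) (V : Fin N → Fin T → Ω → ℝ)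
    (Vstar δ : ℝ) (t : Fin T) : ℝ :=
  (∫ ω, ind (empProb (fun i => V i t) Vstar ω < δ) ∂P) - ind (exceedProb P₀ (X t) Vstar < δ)

end SampleComplexity

namespace SampleComplexity

open Filter Topology

/-! The estimator is a mean of `N` independent Bernoulli variables with parameter `p = P_t`, so
every claim concerns a binomial tail.

Normal approximation: for the standardized sum, the characteristic function differs from `exp (-t ^
2 / 2)` by an amount controlled by `s = √(N p (1 - p))` alone
(`norm_bernoulliCharFun_pow_sub_exp_le`). Along any sequence with `s → ∞`, Lévy's continuity theorem
gives weak convergence and Pólya's theorem makes it uniform in the threshold. A sequence of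
counterexamples is therefore impossible, which yields a `K` depending on `ε` only.

Outside the window, a wrong decision forces a deviation of at least `|p - δ|`, and Chebyshev's
inequality bounds its probability. Inside it, `p (1 - p)` is comparable to `δ (1 - δ)` and the
argument of `Φ` is at most `2c` in absolute value; the normal approximation then keeps the
probability of `P̂_t < δ` away from both 0 and 1, hence away from the indicator. -/

/-! ### The standard normal distribution function. -/

theorem Phi_eq_measureReal (x : ℝ) : Phi x = (gaussianReal 0 1).real (Set.Iic x) :=
  cdf_eq_real _ x

theorem Phi_eq_measureReal_Iio (x : ℝ) : Phi x = (gaussianReal 0 1).real (Set.Iio x) := by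
  have := nullSingletonClass_gaussianReal (μ := 0) (v := 1) one_ne_zero
  rw [Phi_eq_measureReal]
  exact measureReal_congr Iio_ae_eq_Iic.symm

theorem monotone_Phi : Monotone Phi := monotone_cdf _

/-- The jump of a distribution function at `x` is the mass of `{x}`, and the normal law has no
atoms. -/
theorem continuous_Phi : Continuous Phi := by
  have := nullSingletonClass_gaussianReal (μ := 0) (v := 1) one_ne_zero
  refine continuous_iff_continuousAt.2 fun x => ?_
  have h := (cdf (gaussianReal 0 1)).measure_singleton x
  rw [measure_cdf, measure_singleton, eq_comm, ENNReal.ofReal_eq_zero, sub_nonpos] at h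
  refine (monotone_cdf _).continuousAt_iff_leftLim_eq_rightLim.2 ?_
  rw [StieltjesFunction.rightLim_eq]
  exact le_antisymm ((monotone_cdf _).leftLim_le le_rfl) h

theorem exists_Phi_eq {u : ℝ} (h0 : 0 < u) (h1 : u < 1) : ∃ y, Phi y = u := by
  obtain ⟨a, ha⟩ := ((tendsto_cdf_atBot (gaussianReal 0 1)).eventually (gt_mem_nhds h0)).exists
  obtain ⟨b, hb⟩ := ((tendsto_cdf_atTop (gaussianReal 0 1)).eventually (lt_mem_nhds h1)).exists
  exact mem_range_of_exists_le_of_exists_ge continuous_Phi ⟨a, ha.le⟩ ⟨b, hb.le⟩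

/-- Lebesgue measure is absolutely continuous with respect to the normal law, so no half-line is a
null set. -/
theorem Phi_pos (x : ℝ) : 0 < Phi x := by
  rw [Phi_eq_measureReal, measureReal_def]
  refine ENNReal.toReal_pos (fun h => ?_) (measure_ne_top _ _)
  have := gaussianReal_absolutelyContinuous' 0 (v := 1) one_ne_zero h
  simp at this

theorem Phi_lt_one (x : ℝ) : Phi x < 1 := by
  have h : 0 < (gaussianReal 0 1).real (Set.Ioi x) := by
    rw [measureReal_def]
    refine ENNReal.toReal_pos (fun h => ?_) (measure_ne_top _ _)
    have := gaussianReal_absolutelyContinuous' 0 (v := 1) one_ne_zero h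
    simp at this
  rw [Phi_eq_measureReal]
  have := probReal_compl_eq_one_sub (μ := gaussianReal 0 1) (measurableSet_Iic (a := x))
  rw [Set.compl_Iic] at this
  linarith

/-! ### Uniform convergence of distribution functions. -/

/-- Pólya's theorem for the standard normal limit: weak convergence implies uniform convergence of
the distribution functions. -/
theorem eventually_forall_abs_measureReal_Iio_sub_Phi_le {ι : Type*} {L : Filter ι}
    {μ : ι → ProbabilityMeasure ℝ} {γ : ProbabilityMeasure ℝ}
    (hγ : (γ : Measure ℝ) = gaussianReal 0 1) (h : Tendsto μ L (𝓝 γ)) {ε : ℝ} (hε : 0 < ε) :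
    ∀ᶠ k in L, ∀ x, |(μ k : Measure ℝ).real (Set.Iio x) - Phi x| ≤ ε := by
  have hpt (x : ℝ) : Tendsto (fun k => (μ k : Measure ℝ).real (Set.Iio x)) L (𝓝 (Phi x)) := by
    have := nullSingletonClass_gaussianReal (μ := 0) (v := 1) one_ne_zero
    rw [Phi_eq_measureReal_Iio, ← hγ]
    refine (ENNReal.tendsto_toReal (measure_ne_top _ _)).comp
      (ProbabilityMeasure.tendsto_measure_of_null_frontier_of_tendsto' h ?_)
    rw [frontier_Iio, hγ, measure_singleton]
  -- Of the error `2 / n`, one half is the spacing of the quantile grid and the other the error at a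
  -- grid point.
  obtain ⟨n, hn⟩ := exists_nat_gt (2 / ε)
  have hn0 : (0 : ℝ) < n := (by positivity : (0 : ℝ) < 2 / ε).trans hn
  have hnε : 1 / (n : ℝ) + 1 / n ≤ ε := by
    rw [div_lt_iff₀ hε] at hn
    rw [← add_div, div_le_iff₀ hn0]
    linarith
  -- The levels 0 and 1 have no finite quantile; outside `0 < j < n` the value of `y` is irrelevant.
  have hq : ∀ j : ℕ, ∃ y : ℝ, 0 < j → j < n → Phi y = j / n := fun j => by
    by_cases hj : 0 < j ∧ j < n
    · obtain ⟨y, hy⟩ := exists_Phi_eq (u := j / n) (div_pos (by exact_mod_cast hj.1) hn0)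
        ((div_lt_one hn0).2 (by exact_mod_cast hj.2))
      exact ⟨y, fun _ _ => hy⟩
    · exact ⟨0, fun h1 h2 => (hj ⟨h1, h2⟩).elim⟩
  choose y hy using hq
  have hgrid : ∀ᶠ k in L, ∀ j ∈ Finset.range n,
      |(μ k : Measure ℝ).real (Set.Iio (y j)) - Phi (y j)| < 1 / n := by
    rw [eventually_all_finset]
    exact fun j _ => (hpt (y j)).eventually (Metric.ball_mem_nhds _ (by positivity))
  filter_upwards [hgrid] with k hk x
  have hx0 : 0 < Phi x := Phi_pos x
  have hx1 : Phi x < 1 := Phi_lt_one x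
  have hm0 : 0 ≤ (μ k : Measure ℝ).real (Set.Iio x) := measureReal_nonneg
  have hm1 : (μ k : Measure ℝ).real (Set.Iio x) ≤ 1 := measureReal_le_one
  have hnx : 0 ≤ n * Phi x := by positivity
  have hinv : 0 < 1 / (n : ℝ) := by positivity
  rw [abs_sub_le_iff]
  constructor
  -- The next grid level strictly above `Phi x`; if it reaches 1, the trivial bound by 1 suffices.
  · set j := ⌊n * Phi x⌋₊ + 1 with hj
    have hj1 : n * Phi x < j := by rw [hj]; push_cast; exact Nat.lt_floor_add_one _
    have hj2 : (j : ℝ) ≤ n * Phi x + 1 := by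
      rw [hj]; push_cast; linarith [Nat.floor_le hnx]
    have hj2' : (j : ℝ) / n ≤ Phi x + 1 / n := by
      rw [div_le_iff₀ hn0, add_mul, one_div, inv_mul_cancel₀ hn0.ne']; linarith
    by_cases hjn : j < n
    · have hyj := hy j (by omega) hjn
      have hxy : x < y j := monotone_Phi.reflect_lt (by
        rw [hyj, lt_div_iff₀ hn0]; linarith)
      have h1 := (abs_lt.1 (hk j (Finset.mem_range.2 hjn))).2
      have h2 : (μ k : Measure ℝ).real (Set.Iio x) ≤ (μ k : Measure ℝ).real (Set.Iio (y j)) :=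
        measureReal_mono (Set.Iio_subset_Iio hxy.le)
      linarith
    · have : (1 : ℝ) ≤ j / n := by
        rw [le_div_iff₀ hn0, one_mul]; exact_mod_cast not_lt.1 hjn
      linarith
  -- The grid level strictly below `Phi x`; at level 0 nonnegativity of the measure suffices.
  · set j := ⌈n * Phi x⌉₊ - 1 with hj
    have hc : 0 < ⌈n * Phi x⌉₊ := Nat.ceil_pos.2 (by positivity)
    have hjc : (j : ℝ) + 1 = ⌈n * Phi x⌉₊ := by exact_mod_cast Nat.succ_pred_eq_of_pos hc
    have hj1 : (j : ℝ) < n * Phi x := by linarith [Nat.ceil_lt_add_one hnx]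
    have hj2 : n * Phi x ≤ j + 1 := by rw [hjc]; exact Nat.le_ceil _
    have hj2' : Phi x ≤ (j : ℝ) / n + 1 / n := by
      rw [← add_div, le_div_iff₀ hn0]; linarith
    by_cases hj0 : 0 < j
    · have hjn : j < n := by
        have : (j : ℝ) < n := hj1.trans (by nlinarith)
        exact_mod_cast this
      have hyj := hy j hj0 hjn
      have hxy : y j < x := monotone_Phi.reflect_lt (by
        rw [hyj, div_lt_iff₀ hn0]; linarith)
      have h1 := (abs_lt.1 (hk j (Finset.mem_range.2 hjn))).1
      have h2 : (μ k : Measure ℝ).real (Set.Iio (y j)) ≤ (μ k : Measure ℝ).real (Set.Iio x) :=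
        measureReal_mono (Set.Iio_subset_Iio hxy.le)
      linarith
    · have : (j : ℝ) = 0 := by exact_mod_cast Nat.eq_zero_of_not_pos hj0
      rw [this, zero_div] at hj2'
      linarith

/-! ### Quantitative characteristic function estimates. -/

/-- The characteristic function of the Bernoulli variable with success probability `p`, centered
and divided by `s`. -/
noncomputable def bernoulliCharFun (p s t : ℝ) : ℂ :=
  p * Complex.exp ((t * ((1 - p) / s) : ℝ) * Complex.I)
    + (1 - p : ℝ) * Complex.exp ((t * (-p / s) : ℝ) * Complex.I)

theorem norm_bernoulliCharFun_le_one {p : ℝ} (h0 : 0 ≤ p) (h1 : p ≤ 1) (s t : ℝ) :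
    ‖bernoulliCharFun p s t‖ ≤ 1 := by
  refine (norm_add_le _ _).trans_eq ?_
  rw [norm_mul, norm_mul, Complex.norm_exp_ofReal_mul_I, Complex.norm_exp_ofReal_mul_I,
    Complex.norm_real, Complex.norm_real, Real.norm_of_nonneg h0,
    Real.norm_of_nonneg (sub_nonneg.2 h1)]
  ring

theorem norm_pow_sub_pow_le_mul_norm_sub {a b : ℂ} (ha : ‖a‖ ≤ 1) (hb : ‖b‖ ≤ 1) (n : ℕ) :
    ‖a ^ n - b ^ n‖ ≤ n * ‖a - b‖ := by
  induction n with
  | zero => simp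
  | succ n ih =>
    have : a ^ (n + 1) - b ^ (n + 1) = a ^ n * (a - b) + (a ^ n - b ^ n) * b := by ring
    rw [this]
    refine (norm_add_le _ _).trans ?_
    rw [norm_mul, norm_mul, norm_pow]
    have h1 : ‖a‖ ^ n * ‖a - b‖ ≤ 1 * ‖a - b‖ :=
      mul_le_mul_of_nonneg_right (pow_le_one₀ (norm_nonneg _) ha) (norm_nonneg _)
    have h2 : ‖a ^ n - b ^ n‖ * ‖b‖ ≤ ‖a ^ n - b ^ n‖ * 1 :=
      mul_le_mul_of_nonneg_left hb (norm_nonneg _)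
    push_cast
    linarith

theorem norm_exp_mul_I_sub_quadratic_le {y : ℝ} (hy : |y| ≤ 1) :
    ‖Complex.exp (y * Complex.I) - (1 + y * Complex.I - y ^ 2 / 2)‖ ≤ |y| ^ 3 := by
  have hn : ‖(y * Complex.I : ℂ)‖ = |y| := by simp
  have h := Complex.exp_bound (x := y * Complex.I) (by rwa [hn]) (n := 3) (by norm_num)
  have he : ∑ m ∈ Finset.range 3, (y * Complex.I : ℂ) ^ m / m.factorial
      = 1 + y * Complex.I - y ^ 2 / 2 := by
    simp [Finset.sum_range_succ, Nat.factorial, mul_pow]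
    ring
  rw [he, hn] at h
  refine h.trans ?_
  have : 0 ≤ |y| ^ 3 := by positivity
  norm_num [Nat.factorial]
  linarith

/-- Centering cancels the linear Taylor terms and the quadratic ones add up to `t ^ 2 / (2 * N)`.
The cubic remainders carry a factor `p * (1 - p)`, which together with `N` makes `s ^ 2`, so only
`s` survives. -/
theorem norm_bernoulliCharFun_sub_le {p s t : ℝ} {N : ℕ} (h0 : 0 ≤ p) (h1 : p ≤ 1) (hs : 0 < s)
    (hN : s ^ 2 = N * (p * (1 - p))) (ht : |t| ≤ s) :
    N * ‖bernoulliCharFun p s t - (1 - t ^ 2 / (2 * N))‖ ≤ |t| ^ 3 / s := by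
  have hN0 : (N : ℝ) ≠ 0 := fun h => by rw [h, zero_mul] at hN; exact hs.ne' (by simpa using hN)
  have hN0' : (0 : ℝ) ≤ N := N.cast_nonneg
  have hq : 0 ≤ 1 - p := sub_nonneg.2 h1
  have hts : |t| / s ≤ 1 := (div_le_one hs).2 ht
  have hts0 : 0 ≤ |t| / s := by positivity
  have e1 : |t * ((1 - p) / s)| = |t| / s * (1 - p) := by
    rw [abs_mul, abs_div, abs_of_nonneg hq, abs_of_pos hs]; ring
  have e2 : |t * (-p / s)| = |t| / s * p := by
    rw [abs_mul, abs_div, abs_neg, abs_of_nonneg h0, abs_of_pos hs]; ring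
  have b1 := norm_exp_mul_I_sub_quadratic_le (y := t * ((1 - p) / s))
    (by rw [e1]; exact mul_le_one₀ hts hq (by linarith))
  have b2 := norm_exp_mul_I_sub_quadratic_le (y := t * (-p / s))
    (by rw [e2]; exact mul_le_one₀ hts h0 h1)
  rw [e1] at b1
  rw [e2] at b2
  have hpq : t ^ 2 / (2 * N) = p * ((t * ((1 - p) / s)) ^ 2 / 2)
      + (1 - p) * ((t * (-p / s)) ^ 2 / 2) := by
    have hpq0 : p * (1 - p) = s ^ 2 / N := by rw [hN]; field_simp
    have : p * ((t * ((1 - p) / s)) ^ 2 / 2) + (1 - p) * ((t * (-p / s)) ^ 2 / 2)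
        = t ^ 2 / (2 * s ^ 2) * (p * (1 - p)) := by field_simp; ring
    rw [this, hpq0]; field_simp
  have key : bernoulliCharFun p s t - (1 - t ^ 2 / (2 * N))
      = p * (Complex.exp ((t * ((1 - p) / s) : ℝ) * Complex.I)
          - (1 + (t * ((1 - p) / s) : ℝ) * Complex.I - ((t * ((1 - p) / s) : ℝ) : ℂ) ^ 2 / 2))
        + (1 - p : ℝ) * (Complex.exp ((t * (-p / s) : ℝ) * Complex.I)
          - (1 + (t * (-p / s) : ℝ) * Complex.I - ((t * (-p / s) : ℝ) : ℂ) ^ 2 / 2)) := by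
    have hc : (t ^ 2 / (2 * N) : ℂ) = p * (((t * ((1 - p) / s) : ℝ) : ℂ) ^ 2 / 2)
        + (1 - p : ℝ) * (((t * (-p / s) : ℝ) : ℂ) ^ 2 / 2) := by exact_mod_cast hpq
    have hs' : (s : ℂ) ≠ 0 := by exact_mod_cast hs.ne'
    rw [hc, bernoulliCharFun]
    push_cast
    field_simp
    ring
  have hb : ‖bernoulliCharFun p s t - (1 - t ^ 2 / (2 * N))‖
      ≤ p * (|t| / s * (1 - p)) ^ 3 + (1 - p) * (|t| / s * p) ^ 3 := by
    rw [key]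
    refine (norm_add_le _ _).trans ?_
    rw [norm_mul, norm_mul, Complex.norm_real, Complex.norm_real, Real.norm_of_nonneg h0,
      Real.norm_of_nonneg hq]
    gcongr
  have hpq1 : (1 - p) ^ 2 + p ^ 2 ≤ 1 := by nlinarith
  calc N * ‖bernoulliCharFun p s t - (1 - t ^ 2 / (2 * N))‖
      ≤ N * (p * (|t| / s * (1 - p)) ^ 3 + (1 - p) * (|t| / s * p) ^ 3) := by gcongr
    _ = (N * (p * (1 - p))) * (|t| / s) ^ 3 * ((1 - p) ^ 2 + p ^ 2) := by ring
    _ ≤ (N * (p * (1 - p))) * (|t| / s) ^ 3 * 1 := by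
        refine mul_le_mul_of_nonneg_left hpq1 ?_
        rw [← hN]; positivity
    _ = |t| ^ 3 / s := by rw [← hN]; field_simp

theorem norm_bernoulliCharFun_pow_sub_exp_le {p s t : ℝ} {N : ℕ} (h0 : 0 ≤ p) (h1 : p ≤ 1)
    (hs : 0 < s) (hN : s ^ 2 = N * (p * (1 - p))) (ht : |t| ≤ s) :
    ‖bernoulliCharFun p s t ^ N - Complex.exp (-t ^ 2 / 2)‖ ≤ |t| ^ 3 / s + t ^ 4 / s ^ 2 := by
  have hN0 : (N : ℝ) ≠ 0 := fun h => by rw [h, zero_mul] at hN; exact hs.ne' (by simpa using hN)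
  have hNpos : (0 : ℝ) < N := lt_of_le_of_ne N.cast_nonneg hN0.symm
  -- This trades negative powers of `N` for powers of `s`, the only parameter in the final bound.
  have hsN : s ^ 2 ≤ N := by
    rw [hN]
    exact mul_le_of_le_one_right hNpos.le (by nlinarith)
  have htN : t ^ 2 ≤ N := (sq_le_sq' (by linarith [abs_nonneg t, neg_abs_le t])
    ((le_abs_self t).trans ht)).trans hsN
  set b : ℂ := Complex.exp ((-(t ^ 2 / (2 * N)) : ℝ)) with hb
  have hbN : Complex.exp (-t ^ 2 / 2) = b ^ N := by
    rw [hb, ← Complex.exp_nat_mul]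
    congr 1
    have : (N : ℂ) ≠ 0 := by exact_mod_cast hN0
    push_cast
    field_simp
  have hb1 : ‖b‖ ≤ 1 := by
    rw [hb, Complex.norm_exp_ofReal, Real.exp_le_one_iff, neg_nonpos]
    positivity
  have hx1 : |(-(t ^ 2 / (2 * N)) : ℝ)| ≤ 1 := by
    rw [abs_neg, abs_of_nonneg (by positivity), div_le_one (by positivity)]
    linarith
  have hbq : ‖(1 - t ^ 2 / (2 * N) : ℂ) - b‖ ≤ (t ^ 2 / (2 * N)) ^ 2 := by
    have := Real.abs_exp_sub_one_sub_id_le hx1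
    rw [neg_sq] at this
    rw [norm_sub_rev, hb, ← Complex.ofReal_exp]
    refine le_trans (le_of_eq ?_) this
    rw [← Real.norm_eq_abs, ← Complex.norm_real]
    congr 1
    push_cast
    ring
  rw [hbN]
  calc ‖bernoulliCharFun p s t ^ N - b ^ N‖
      ≤ N * ‖bernoulliCharFun p s t - b‖ :=
        norm_pow_sub_pow_le_mul_norm_sub (norm_bernoulliCharFun_le_one h0 h1 s t) hb1 N
    _ ≤ N * (‖bernoulliCharFun p s t - (1 - t ^ 2 / (2 * N))‖ + (t ^ 2 / (2 * N)) ^ 2) := by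
        gcongr
        exact (norm_sub_le_norm_sub_add_norm_sub _ _ _).trans (by gcongr)
    _ ≤ |t| ^ 3 / s + N * (t ^ 2 / (2 * N)) ^ 2 := by
        rw [mul_add]
        gcongr
        exact norm_bernoulliCharFun_sub_le h0 h1 hs hN ht
    _ ≤ |t| ^ 3 / s + t ^ 4 / s ^ 2 := by
        gcongr
        calc N * (t ^ 2 / (2 * N)) ^ 2 = t ^ 4 / (4 * N) := by field_simp; norm_num
          _ ≤ t ^ 4 / s ^ 2 := by
            gcongr
            linarith

/-! ### The uniform central limit theorem. -/

/-- Uniform central limit theorem for standardized binomial laws. -/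
theorem exists_forall_abs_measureReal_Iio_sub_Phi_le {ε : ℝ} (hε : 0 < ε) :
    ∃ K : ℝ, 0 < K ∧ ∀ (N : ℕ) (p : ℝ) (μ : Measure ℝ) [IsProbabilityMeasure μ],
      0 ≤ p → p ≤ 1 → K ≤ N * (p * (1 - p)) →
      (∀ t, charFun μ t = bernoulliCharFun p √(N * (p * (1 - p))) t ^ N) →
      ∀ x, |μ.real (Set.Iio x) - Phi x| ≤ ε := by
  -- Failure for every `K = k + 1` gives a sequence of laws on `ℝ` with `N p (1 - p) → ∞`, each
  -- violating the bound somewhere.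
  by_contra! hcon
  choose N p μ hμ hp0 hp1 hK hchar x hx using fun k : ℕ => hcon (k + 1) (by positivity)
  have hs : Tendsto (fun k => √(N k * (p k * (1 - p k)))) atTop atTop :=
    Real.tendsto_sqrt_atTop.comp (tendsto_atTop_mono (fun k => (by linarith [hK k] :
      (k : ℝ) ≤ N k * (p k * (1 - p k)))) tendsto_natCast_atTop_atTop)
  let ν : ℕ → ProbabilityMeasure ℝ := fun k => ⟨μ k, hμ k⟩
  let γ : ProbabilityMeasure ℝ := ⟨gaussianReal 0 1, inferInstance⟩
  have hlim : Tendsto ν atTop (𝓝 γ) := by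
    refine ProbabilityMeasure.tendsto_of_tendsto_charFun fun t => ?_
    rw [tendsto_iff_norm_sub_tendsto_zero]
    have hbound : Tendsto (fun k => |t| ^ 3 / √(N k * (p k * (1 - p k)))
        + t ^ 4 / √(N k * (p k * (1 - p k))) ^ 2) atTop (𝓝 0) := by
      simpa using (hs.const_div_atTop _).add
        (((tendsto_pow_atTop two_ne_zero).comp hs).const_div_atTop (t ^ 4))
    refine squeeze_zero' (.of_forall fun _ => norm_nonneg _) ?_ hbound
    filter_upwards [hs.eventually_ge_atTop |t|] with k hk
    have hpos : (0 : ℝ) < N k * (p k * (1 - p k)) := lt_of_lt_of_le (by positivity) (hK k)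
    have := norm_bernoulliCharFun_pow_sub_exp_le (hp0 k) (hp1 k) (Real.sqrt_pos.2 hpos)
      (Real.sq_sqrt hpos.le) hk
    simpa [ν, γ, hchar, charFun_gaussianReal, neg_div] using this
  obtain ⟨k, hk⟩ := (eventually_forall_abs_measureReal_Iio_sub_Phi_le rfl hlim hε).exists
  exact (hx k).not_ge (hk (x k))

/-! ### Indicators and the law of the empirical probability. -/

theorem ind_eq_one_iff {q : Prop} : ind q = 1 ↔ q := by
  unfold ind
  split_ifs with h <;> simp [h]

theorem ind_of_true {q : Prop} (h : q) : ind q = 1 := ind_eq_one_iff.2 h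

theorem ind_of_false {q : Prop} (h : ¬q) : ind q = 0 := if_neg h

theorem ind_mem_Icc (q : Prop) : ind q ∈ Set.Icc (0 : ℝ) 1 := by
  by_cases h : q
  · simp [ind_of_true h]
  · simp [ind_of_false h]

theorem ind_mem_eq_indicator {α : Type*} (s : Set α) :
    (fun x => ind (x ∈ s)) = s.indicator (fun _ => 1) := by
  ext x
  by_cases h : x ∈ s
  · simp [h, ind_of_true]
  · simp [h, ind_of_false]

theorem measurable_ind_ge (a : ℝ) : Measurable fun x : ℝ => ind (x ≥ a) := by
  have : (fun x : ℝ => ind (x ≥ a)) = (Set.Ici a).indicator fun _ => 1 :=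
    ind_mem_eq_indicator (Set.Ici a)
  rw [this]
  exact measurable_const.indicator measurableSet_Ici

theorem measurable_ind_lt (a : ℝ) : Measurable fun x : ℝ => ind (x < a) := by
  have : (fun x : ℝ => ind (x < a)) = (Set.Iio a).indicator fun _ => 1 :=
    ind_mem_eq_indicator (Set.Iio a)
  rw [this]
  exact measurable_const.indicator measurableSet_Iio

section
variable {Ω : Type*} [MeasurableSpace Ω] {P : Measure Ω} {N : ℕ} {V : Fin N → Ω → ℝ}

theorem integral_ind {s : Set Ω} (hs : NullMeasurableSet s P) :
    ∫ ω, ind (ω ∈ s) ∂P = P.real s := by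
  rw [ind_mem_eq_indicator, integral_indicator₀ hs]
  simp

theorem nullMeasurableSet_ge {X : Ω → ℝ} (hX : AEMeasurable X P) (a : ℝ) :
    NullMeasurableSet {ω | X ω ≥ a} P :=
  nullMeasurableSet_le aemeasurable_const hX

theorem integral_ind_ge {X : Ω → ℝ} (hX : AEMeasurable X P) (a : ℝ) :
    ∫ ω, ind (X ω ≥ a) ∂P = exceedProb P X a :=
  integral_ind (nullMeasurableSet_ge hX a)

theorem aemeasurable_empProb (hV : ∀ i, AEMeasurable (V i) P) (a : ℝ) :
    AEMeasurable (empProb V a) P :=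
  (Finset.aemeasurable_fun_sum _ fun i _ =>
    (measurable_ind_ge a).comp_aemeasurable (hV i)).const_mul _

theorem integral_ind_empProb_lt (hV : ∀ i, AEMeasurable (V i) P) (a δ : ℝ) :
    ∫ ω, ind (empProb V a ω < δ) ∂P = P.real {ω | empProb V a ω < δ} :=
  integral_ind (nullMeasurableSet_lt (aemeasurable_empProb hV a) aemeasurable_const)

variable [IsProbabilityMeasure P]

theorem charFun_standardized_ind {X : Ω → ℝ} (hX : AEMeasurable X P) (a s t : ℝ) :
    charFun (P.map fun ω => (ind (X ω ≥ a) - exceedProb P X a) / s) t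
      = bernoulliCharFun (exceedProb P X a) s t := by
  set p := exceedProb P X a with hp
  have hm : AEMeasurable (fun ω => (ind (X ω ≥ a) - p) / s) P :=
    (((measurable_ind_ge a).comp_aemeasurable hX).sub_const p).div_const s
  rw [charFun_apply_real, integral_map hm (by fun_prop)]
  set c : ℂ := Complex.exp ((t * ((1 - p) / s) : ℝ) * Complex.I) with hc
  set d : ℂ := Complex.exp ((t * (-p / s) : ℝ) * Complex.I) with hd
  have hA := nullMeasurableSet_ge hX a
  -- The integrand takes only the values `c` and `d`, so its integral is `p * c + (1 - p) * d`.
  have heq : (fun ω => Complex.exp (t * ((ind (X ω ≥ a) - p) / s : ℝ) * Complex.I))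
      = fun ω => {ω | X ω ≥ a}.indicator (fun _ => c - d) ω + d := by
    ext ω
    by_cases h : X ω ≥ a
    · rw [Set.indicator_of_mem (by exact h), ind_of_true h, hc]
      push_cast
      ring
    · rw [Set.indicator_of_notMem (by exact h), ind_of_false h, hd]
      push_cast
      ring_nf
  rw [heq, integral_add ((integrable_const _).indicator₀ hA) (integrable_const _),
    integral_indicator₀ hA, setIntegral_const, integral_const, probReal_univ]
  change (p : ℝ) • (c - d) + (1 : ℝ) • d = _
  rw [bernoulliCharFun, ← hc, ← hd, Complex.real_smul, Complex.real_smul]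
  push_cast
  ring

theorem integrable_ind_empProb_lt (hV : ∀ i, AEMeasurable (V i) P) (a δ : ℝ) :
    Integrable (fun ω => ind (empProb V a ω < δ)) P :=
  Integrable.of_bound
    ((measurable_ind_lt δ).comp_aemeasurable (aemeasurable_empProb hV a)).aestronglyMeasurable 1
    (.of_forall fun ω => by
      have := ind_mem_Icc (empProb V a ω < δ)
      rw [Real.norm_of_nonneg this.1]
      exact this.2)

theorem charFun_standardized_sum (hV : ∀ i, AEMeasurable (V i) P) (hind : iIndepFun V P)
    {a p : ℝ} (hp : ∀ i, exceedProb P (V i) a = p) (s t : ℝ) :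
    charFun (P.map fun ω => ∑ i, (ind (V i ω ≥ a) - p) / s) t = bernoulliCharFun p s t ^ N := by
  have hg : Measurable fun x : ℝ => (ind (x ≥ a) - p) / s :=
    ((measurable_ind_ge a).sub_const p).div_const s
  have hind' := hind.comp (fun _ x => (ind (x ≥ a) - p) / s) fun _ => hg
  have h := hind'.charFun_map_fun_sum_eq_prod fun i => hg.comp_aemeasurable (hV i)
  simp only [Function.comp_apply] at h
  rw [h, Finset.prod_apply]
  have : ∀ i, charFun (P.map ((fun x => (ind (x ≥ a) - p) / s) ∘ V i)) t
      = bernoulliCharFun p s t := fun i => by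
    have := charFun_standardized_ind (hV i) a s t
    rwa [hp i] at this
  rw [Finset.prod_congr rfl fun i _ => this i]
  simp

end

theorem empProb_lt_iff {Ω : Type*} {N : ℕ} {V : Fin N → Ω → ℝ} {a p s δ : ℝ} (hN : 0 < N) (hs : 0 < s) (ω : Ω) :
    empProb V a ω < δ ↔ ∑ i, (ind (V i ω ≥ a) - p) / s < (δ - p) * N / s := by
  have hN' : (0 : ℝ) < N := by exact_mod_cast hN
  rw [← Finset.sum_div, Finset.sum_sub_distrib, div_lt_div_iff_of_pos_right hs, empProb,
    one_div_mul_eq_div, div_lt_iff₀ hN']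
  simp only [Finset.sum_const, Finset.card_univ, Fintype.card_fin, nsmul_eq_mul]
  constructor <;> intro h <;> linarith

/-- Normal approximation of the distribution function of the empirical probability, with an error
that depends on `N p (1 - p)` only. -/
theorem exists_forall_abs_measureReal_empProb_lt_sub_Phi_le {ε : ℝ} (hε : 0 < ε) :
    ∃ K : ℝ, 0 < K ∧ ∀ (N : ℕ) (Ω : Type v) [MeasurableSpace Ω] (P : Measure Ω)
      [IsProbabilityMeasure P] (V : Fin N → Ω → ℝ), (∀ i, AEMeasurable (V i) P) →
      iIndepFun V P → ∀ a p : ℝ, (∀ i, exceedProb P (V i) a = p) → K ≤ N * (p * (1 - p)) →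
      ∀ δ : ℝ, |P.real {ω | empProb V a ω < δ} - Phi ((δ - p) * √N / √(p * (1 - p)))| ≤ ε := by
  obtain ⟨K, hK, h⟩ := exists_forall_abs_measureReal_Iio_sub_Phi_le hε
  refine ⟨K, hK, fun N Ω _ P _ V hV hind a p hp hKN δ => ?_⟩
  have hpos := hK.trans_le hKN
  have hN : 0 < N := Nat.pos_of_ne_zero fun h0 => by simp [h0] at hpos
  have hN' : (0 : ℝ) < N := by exact_mod_cast hN
  have hpq : 0 < p * (1 - p) := pos_of_mul_pos_right hpos hN'.le
  have hp0 : 0 ≤ p := hp ⟨0, hN⟩ ▸ measureReal_nonneg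
  have hp1 : p ≤ 1 := hp ⟨0, hN⟩ ▸ measureReal_le_one
  set s := √(N * (p * (1 - p))) with hs
  have hs0 : 0 < s := Real.sqrt_pos.2 hpos
  have hm : AEMeasurable (fun ω => ∑ i, (ind (V i ω ≥ a) - p) / s) P :=
    Finset.aemeasurable_fun_sum _ fun i _ =>
      (((measurable_ind_ge a).comp_aemeasurable (hV i)).sub_const p).div_const s
  have := Measure.isProbabilityMeasure_map hm
  have key := h N p (P.map fun ω => ∑ i, (ind (V i ω ≥ a) - p) / s) hp0 hp1 hKN
    (charFun_standardized_sum hV hind hp s) ((δ - p) * N / s)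
  rw [map_measureReal_apply_of_aemeasurable hm measurableSet_Iio] at key
  have hset : {ω | empProb V a ω < δ}
      = (fun ω => ∑ i, (ind (V i ω ≥ a) - p) / s) ⁻¹' Set.Iio ((δ - p) * N / s) :=
    Set.ext fun ω => empProb_lt_iff hN hs0 ω
  have hx : (δ - p) * √N / √(p * (1 - p)) = (δ - p) * N / s := by
    rw [hs, Real.sqrt_mul hN'.le]
    have h1 := Real.sqrt_pos.2 hN'
    have h2 := Real.sqrt_pos.2 hpq
    field_simp
    rw [Real.sq_sqrt hN'.le]
  rwa [hset, hx]

/-! ### Variance and Chebyshev bounds. -/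

section
variable {Ω : Type*} [MeasurableSpace Ω] {P : Measure Ω} [IsProbabilityMeasure P]
  {N : ℕ} {V : Fin N → Ω → ℝ}

theorem memLp_ind_ge {X : Ω → ℝ} (hX : AEMeasurable X P) (a : ℝ) :
    MemLp (fun ω => ind (X ω ≥ a)) 2 P :=
  MemLp.of_bound ((measurable_ind_ge a).comp_aemeasurable hX).aestronglyMeasurable 1
    (.of_forall fun ω => by
      have := ind_mem_Icc (X ω ≥ a)
      rw [Real.norm_of_nonneg this.1]
      exact this.2)

theorem integral_empProb (hN : 0 < N) (hV : ∀ i, AEMeasurable (V i) P) {a p : ℝ}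
    (hp : ∀ i, exceedProb P (V i) a = p) : ∫ ω, empProb V a ω ∂P = p := by
  have hN' : (N : ℝ) ≠ 0 := by exact_mod_cast hN.ne'
  simp only [empProb]
  rw [integral_const_mul,
    integral_finsetSum _ fun i _ => (memLp_ind_ge (hV i) a).integrable one_le_two,
    Finset.sum_congr rfl fun i _ => (integral_ind_ge (hV i) a).trans (hp i)]
  simp [hN']

theorem memLp_empProb (hV : ∀ i, AEMeasurable (V i) P) (a : ℝ) : MemLp (empProb V a) 2 P :=
  (memLp_finsetSum _ fun i _ => memLp_ind_ge (hV i) a).const_mul _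

theorem variance_empProb_le (hN : 0 < N) (hV : ∀ i, AEMeasurable (V i) P) (hind : iIndepFun V P)
    {a p : ℝ} (hp : ∀ i, exceedProb P (V i) a = p) :
    Var[empProb V a; P] ≤ p * (1 - p) / N := by
  have hN' : (0 : ℝ) < N := by exact_mod_cast hN
  have hsum : Var[∑ i, fun ω => ind (V i ω ≥ a); P] = ∑ i, Var[fun ω => ind (V i ω ≥ a); P] :=
    IndepFun.variance_sum (fun i _ => memLp_ind_ge (hV i) a) fun i _ j _ hij =>
      (hind.indepFun hij).comp (measurable_ind_ge a) (measurable_ind_ge a)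
  have hfun : (fun ω => ∑ i, ind (V i ω ≥ a)) = ∑ i, fun ω => ind (V i ω ≥ a) := by
    ext ω; simp
  have hone (i : Fin N) : Var[fun ω => ind (V i ω ≥ a); P] ≤ p * (1 - p) := by
    -- For values in `[0, 1]` with mean `p` the variance is at most `(1 - p) * (p - 0)`.
    have h := variance_le_sub_mul_sub (μ := P) (X := fun ω => ind (V i ω ≥ a)) (a := 0) (b := 1)
      (.of_forall fun ω => ind_mem_Icc _)
      ((measurable_ind_ge a).comp_aemeasurable (hV i))
    rw [integral_ind_ge (hV i), hp i] at h
    linarith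
  have heq : Var[empProb V a; P] = (1 / (N : ℝ)) ^ 2 * ∑ i, Var[fun ω => ind (V i ω ≥ a); P] := by
    rw [← hsum, ← hfun, ← variance_const_mul]
    rfl
  rw [heq]
  calc (1 / (N : ℝ)) ^ 2 * ∑ i, Var[fun ω => ind (V i ω ≥ a); P]
      ≤ (1 / (N : ℝ)) ^ 2 * ∑ _i : Fin N, p * (1 - p) := by
        gcongr with i
        exact hone i
    _ = p * (1 - p) / N := by
        simp only [Finset.sum_const, Finset.card_univ, Fintype.card_fin, nsmul_eq_mul]
        field_simp

/-- Chebyshev's inequality for the empirical probability. -/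
theorem measureReal_le_abs_empProb_sub_le (hN : 0 < N) (hV : ∀ i, AEMeasurable (V i) P)
    (hind : iIndepFun V P) {a p : ℝ} (hp : ∀ i, exceedProb P (V i) a = p) {d : ℝ} (hd : 0 < d) :
    P.real {ω | d ≤ |empProb V a ω - p|} ≤ p * (1 - p) / (N * d ^ 2) := by
  have h := meas_ge_le_variance_div_sq (memLp_empProb hV a) hd
  rw [integral_empProb hN hV hp] at h
  refine (ENNReal.toReal_mono ENNReal.ofReal_ne_top h).trans ?_
  rw [ENNReal.toReal_ofReal (div_nonneg (variance_nonneg _ _) (sq_nonneg d)), ← div_div]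
  gcongr
  exact variance_empProb_le hN hV hind hp

/-- The error probability of deciding `p < δ` by `empProb < δ` is at most the probability that the
estimate deviates from `p` by at least `|p - δ|`. -/
theorem abs_integral_ind_sub_ind_le (hV : ∀ i, AEMeasurable (V i) P) (a p δ : ℝ) :
    |(∫ ω, ind (empProb V a ω < δ) ∂P) - ind (p < δ)|
      ≤ P.real {ω | |p - δ| ≤ |empProb V a ω - p|} := by
  rw [integral_ind_empProb_lt hV]
  by_cases h : p < δ
  · have hc := probReal_compl_eq_one_sub₀ (μ := P)
      (nullMeasurableSet_lt (aemeasurable_empProb hV a) (aemeasurable_const (b := δ)))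
    rw [ind_of_true h, abs_sub_comm, ← hc, abs_of_nonneg measureReal_nonneg]
    refine measureReal_mono fun ω hω => ?_
    have hω' : δ ≤ empProb V a ω := not_lt.1 hω
    change |p - δ| ≤ |empProb V a ω - p|
    rw [abs_sub_comm, abs_of_pos (sub_pos.2 h)]
    exact (sub_le_sub_right hω' p).trans (le_abs_self _)
  · rw [ind_of_false h, sub_zero, abs_of_nonneg measureReal_nonneg]
    refine measureReal_mono fun ω hω => ?_
    have hω' : empProb V a ω < δ := hω
    change |p - δ| ≤ |empProb V a ω - p|
    rw [abs_of_nonneg (sub_nonneg.2 (not_lt.1 h)), abs_sub_comm]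
    exact (sub_le_sub_left hω'.le p).trans (le_abs_self _)

end

/-! ### Training runs and the total bias. -/

section
variable {Ω₀ Ω : Type*} [MeasurableSpace Ω₀] [MeasurableSpace Ω] {N T : ℕ}
  {P₀ : Measure Ω₀} {P : Measure Ω} {X : Fin T → Ω₀ → ℝ} {V : Fin N → Fin T → Ω → ℝ}

theorem IsIIDRuns.aemeasurable (h : IsIIDRuns P₀ X P V) (t : Fin T) (i : Fin N) :
    AEMeasurable (V i t) P :=
  (h.identDistrib t i).aemeasurable_fst

theorem IsIIDRuns.exceedProb_eq (h : IsIIDRuns P₀ X P V) (a : ℝ) (t : Fin T) (i : Fin N) :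
    exceedProb P (V i t) a = exceedProb P₀ (X t) a :=
  congrArg ENNReal.toReal ((h.identDistrib t i).measure_mem_eq (measurableSet_Ici (a := a)))

theorem integral_empSampleComplexity_sub [IsProbabilityMeasure P] (h : IsIIDRuns P₀ X P V)
    (a δ : ℝ) :
    (∫ ω, empSampleComplexity V a δ ω ∂P) - sampleComplexity P₀ X a δ
      = ∑ t, biasAt P₀ X P V a δ t := by
  simp only [empSampleComplexity, sampleComplexity, biasAt]
  rw [integral_finsetSum _ fun t _ => integrable_ind_empProb_lt (h.aemeasurable t) a δ,
    Finset.sum_sub_distrib]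

end

/-! ### Arithmetic of the window. -/

/-- Lets the variance at `p` be replaced by that at `δ`, at the cost of `|p - δ|`. -/
theorem abs_mul_one_sub_sub_mul_one_sub_le {p δ : ℝ} (hp0 : 0 ≤ p) (hp1 : p ≤ 1) (h0 : 0 ≤ δ)
    (h1 : δ ≤ 1) : |p * (1 - p) - δ * (1 - δ)| ≤ |p - δ| := by
  have : p * (1 - p) - δ * (1 - δ) = (p - δ) * (1 - p - δ) := by ring
  rw [this, abs_mul]
  exact mul_le_of_le_one_right (abs_nonneg _) (abs_le.2 ⟨by linarith, by linarith⟩)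

/-- Outside the window of half width `c √(δ (1 - δ) / N)` the Chebyshev bound is small. -/
theorem chebyshev_bound_le {N p δ c ε : ℝ} (hN : 0 < N) (hp0 : 0 ≤ p) (hp1 : p ≤ 1)
    (h0 : 0 < δ) (h1 : δ < 1) (hε : 0 < ε) (hc : 2 / ε + 1 ≤ c) (hK : 1 ≤ N * (δ * (1 - δ)))
    (hd : c * √(δ * (1 - δ) / N) ≤ |p - δ|) :
    p * (1 - p) / (N * |p - δ| ^ 2) ≤ ε := by
  set d := |p - δ| with hdd
  set v := δ * (1 - δ) with hv
  have hv0 : 0 < v := mul_pos h0 (by linarith)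
  have hc1 : 1 ≤ c := by linarith [(by positivity : 0 < 2 / ε)]
  have hcε : 2 ≤ ε * c := by
    have : 2 / ε ≤ c := by linarith
    rw [div_le_iff₀ hε] at this
    linarith
  have hd0 : 0 < d := lt_of_lt_of_le (by positivity) hd
  have hpv : p * (1 - p) ≤ v + d := by
    linarith [(abs_le.1 (abs_mul_one_sub_sub_mul_one_sub_le hp0 hp1 h0.le h1.le)).2]
  have hsq : c ^ 2 * v ≤ N * d ^ 2 := by
    have := pow_le_pow_left₀ (by positivity) hd 2
    rw [mul_pow, Real.sq_sqrt (by positivity)] at this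
    rw [← mul_div_assoc, div_le_iff₀ hN] at this
    linarith
  -- The variance bound `v + d` has two terms: `hsq` handles `v`, and this bound, which needs `1 ≤ N
  -- * v`, handles `d`.
  have hNd : c ≤ N * d := by
    have h2 : c ^ 2 ≤ (N * d) ^ 2 := by
      calc c ^ 2 = c ^ 2 * 1 := (mul_one _).symm
        _ ≤ c ^ 2 * (N * v) := by gcongr
        _ = N * (c ^ 2 * v) := by ring
        _ ≤ N * (N * d ^ 2) := by gcongr
        _ = (N * d) ^ 2 := by ring
    exact le_of_sq_le_sq h2 (by positivity)
  rw [div_le_iff₀ (by positivity)]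
  have e1 : 2 * v ≤ ε * (N * d ^ 2) := by
    calc 2 * v ≤ (ε * c) * v := by gcongr
      _ ≤ (ε * c) * v * c := le_mul_of_one_le_right (by positivity) hc1
      _ = ε * (c ^ 2 * v) := by ring
      _ ≤ ε * (N * d ^ 2) := by gcongr
  have e2 : 2 * d ≤ ε * (N * d ^ 2) := by
    calc 2 * d ≤ (ε * c) * d := by gcongr
      _ = ε * d * c := by ring
      _ ≤ ε * d * (N * d) := by gcongr
      _ = ε * (N * d ^ 2) := by ring
  linarith

/-- Inside the window of half width `c √(δ (1 - δ) / N)` the variance is comparable to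
`δ (1 - δ)` and the standardized distance is bounded. -/
theorem window_bounds {N p δ c : ℝ} (hN : 0 < N) (hp0 : 0 ≤ p) (hp1 : p ≤ 1)
    (h0 : 0 < δ) (h1 : δ < 1) (hc : 0 < c) (hK : 4 * c ^ 2 ≤ N * (δ * (1 - δ)))
    (hd : |p - δ| ≤ c * √(δ * (1 - δ) / N)) :
    δ * (1 - δ) / 2 ≤ p * (1 - p) ∧ |(δ - p) * √N / √(p * (1 - p))| ≤ 2 * c := by
  set v := δ * (1 - δ) with hv
  have hv0 : 0 < v := mul_pos h0 (by linarith)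
  -- The threshold `4 * c ^ 2` is what makes the window narrow enough to lose at most half the
  -- variance.
  have hdv : c * √(v / N) ≤ v / 2 := by
    refine abs_le_of_sq_le_sq' ?_ (by positivity) |>.2
    rw [mul_pow, Real.sq_sqrt (by positivity), ← mul_div_assoc, div_le_iff₀ hN]
    nlinarith
  have hpv : v / 2 ≤ p * (1 - p) := by
    linarith [(abs_le.1 (abs_mul_one_sub_sub_mul_one_sub_le hp0 hp1 h0.le h1.le)).1]
  refine ⟨hpv, ?_⟩
  have hpq : 0 < p * (1 - p) := by linarith
  rw [abs_div, abs_mul, abs_of_nonneg (Real.sqrt_nonneg N), abs_of_nonneg (Real.sqrt_nonneg _),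
    div_le_iff₀ (Real.sqrt_pos.2 hpq), abs_sub_comm]
  calc |p - δ| * √N ≤ c * √(v / N) * √N := by gcongr
    _ = c * √v := by rw [mul_assoc, ← Real.sqrt_mul (by positivity), div_mul_cancel₀ _ hN.ne']
    _ ≤ c * √(2 ^ 2 * (p * (1 - p))) := by gcongr; linarith
    _ = 2 * c * √(p * (1 - p)) := by
        rw [Real.sqrt_mul (by positivity), Real.sqrt_sq (by norm_num)]; ring

theorem natCast_pos_of_le_mul {N : ℕ} {K x : ℝ} (hK : 0 < K) (h : K ≤ N * x) : 0 < N :=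
  Nat.pos_of_ne_zero fun h0 => by simp [h0] at h; linarith

end SampleComplexity

/-! ### The main theorem. -/

theorem mainTheorem2 :
    -- `P(𝕀[P̂_t < δ] = 1) = P(P̂_t < δ)`, and the bias of `Ŝ` is the sum of the biases at the
    -- single times
    (∀ (N T : ℕ) (Ω₀ : Type u) (Ω : Type v) [MeasurableSpace Ω₀] [MeasurableSpace Ω]
      (P₀ : Measure Ω₀) (P : Measure Ω) [IsProbabilityMeasure P₀] [IsProbabilityMeasure P]
      (X : Fin T → Ω₀ → ℝ) (V : Fin N → Fin T → Ω → ℝ),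
      SampleComplexity.IsIIDRuns P₀ X P V → ∀ (Vstar δ : ℝ), 0 < δ → δ ≤ 1 →
      (∀ t : Fin T,
        P.real {ω | SampleComplexity.ind
            (SampleComplexity.empProb (fun i => V i t) Vstar ω < δ) = 1}
          = P.real {ω | SampleComplexity.empProb (fun i => V i t) Vstar ω < δ}) ∧
      (∫ ω, SampleComplexity.empSampleComplexity V Vstar δ ω ∂P)
          - SampleComplexity.sampleComplexity P₀ X Vstar δ
        = ∑ t, SampleComplexity.biasAt P₀ X P V Vstar δ t) ∧
    -- normal approximation, uniformly in the threshold `δ`, the process and the time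
    (∀ ε : ℝ, 0 < ε → ∃ K : ℝ, 0 < K ∧
      ∀ (N T : ℕ) (Ω₀ : Type u) (Ω : Type v) [MeasurableSpace Ω₀] [MeasurableSpace Ω]
        (P₀ : Measure Ω₀) (P : Measure Ω) [IsProbabilityMeasure P₀] [IsProbabilityMeasure P]
        (X : Fin T → Ω₀ → ℝ) (V : Fin N → Fin T → Ω → ℝ),
        SampleComplexity.IsIIDRuns P₀ X P V → ∀ (Vstar : ℝ) (t : Fin T) (p σ : ℝ),
        p = SampleComplexity.exceedProb P₀ (X t) Vstar → σ = √(p * (1 - p)) →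
        K ≤ N * (p * (1 - p)) →
        ∀ δ : ℝ, 0 < δ → δ ≤ 1 →
          |P.real {ω | SampleComplexity.ind
              (SampleComplexity.empProb (fun i => V i t) Vstar ω < δ) = 1}
            - SampleComplexity.Phi ((δ - p) * √N / σ)| ≤ ε) ∧
    -- outside a window of width of order `√(δ(1-δ)/N)` around `P_t = δ` the bias is small
    (∀ ε : ℝ, 0 < ε → ∃ c K : ℝ, 0 < c ∧ 0 < K ∧
      ∀ (N T : ℕ) (Ω₀ : Type u) (Ω : Type v) [MeasurableSpace Ω₀] [MeasurableSpace Ω]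
        (P₀ : Measure Ω₀) (P : Measure Ω) [IsProbabilityMeasure P₀] [IsProbabilityMeasure P]
        (X : Fin T → Ω₀ → ℝ) (V : Fin N → Fin T → Ω → ℝ),
        SampleComplexity.IsIIDRuns P₀ X P V → ∀ (Vstar δ : ℝ) (t : Fin T), 0 < δ → δ < 1 →
        K ≤ N * (δ * (1 - δ)) →
        c * √(δ * (1 - δ) / N) ≤ |SampleComplexity.exceedProb P₀ (X t) Vstar - δ| →
          |SampleComplexity.biasAt P₀ X P V Vstar δ t| ≤ ε) ∧
    -- inside each window of width of that order the bias stays away from zero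
    (∀ c : ℝ, 0 < c → ∃ η K : ℝ, 0 < η ∧ 0 < K ∧
      ∀ (N T : ℕ) (Ω₀ : Type u) (Ω : Type v) [MeasurableSpace Ω₀] [MeasurableSpace Ω]
        (P₀ : Measure Ω₀) (P : Measure Ω) [IsProbabilityMeasure P₀] [IsProbabilityMeasure P]
        (X : Fin T → Ω₀ → ℝ) (V : Fin N → Fin T → Ω → ℝ),
        SampleComplexity.IsIIDRuns P₀ X P V → ∀ (Vstar δ : ℝ) (t : Fin T), 0 < δ → δ < 1 →
        K ≤ N * (δ * (1 - δ)) →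
        |SampleComplexity.exceedProb P₀ (X t) Vstar - δ| ≤ c * √(δ * (1 - δ) / N) →
          η ≤ |SampleComplexity.biasAt P₀ X P V Vstar δ t|) := by
  refine ⟨?_, ?_, ?_, ?_⟩
  · intro N T Ω₀ Ω _ _ P₀ P _ _ X V hruns a δ _ _
    refine ⟨fun t => ?_, SampleComplexity.integral_empSampleComplexity_sub hruns a δ⟩
    simp only [SampleComplexity.ind_eq_one_iff]
  · intro ε hε
    obtain ⟨K, hK, h⟩ :=
      SampleComplexity.exists_forall_abs_measureReal_empProb_lt_sub_Phi_le.{v} hε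
    refine ⟨K, hK, fun N T Ω₀ Ω _ _ P₀ P _ _ X V hruns a t p σ hp hσ hKN δ _ _ => ?_⟩
    simp only [SampleComplexity.ind_eq_one_iff]
    rw [hσ]
    exact h N Ω P (fun i => V i t) (hruns.aemeasurable t) (hruns.indep t) a p
      (fun i => (hruns.exceedProb_eq a t i).trans hp.symm) hKN δ
  · intro ε hε
    refine ⟨2 / ε + 1, 1, by positivity, one_pos, ?_⟩
    intro N T Ω₀ Ω _ _ P₀ P _ _ X V hruns a δ t h0 h1 hKN hd
    have hN := SampleComplexity.natCast_pos_of_le_mul one_pos hKN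
    have hN' : (0 : ℝ) < N := by exact_mod_cast hN
    have hv : 0 < δ * (1 - δ) := mul_pos h0 (by linarith)
    refine (SampleComplexity.abs_integral_ind_sub_ind_le (hruns.aemeasurable t) a _ δ).trans ?_
    refine (SampleComplexity.measureReal_le_abs_empProb_sub_le hN (hruns.aemeasurable t)
      (hruns.indep t) (hruns.exceedProb_eq a t) (lt_of_lt_of_le (by positivity) hd)).trans ?_
    exact SampleComplexity.chebyshev_bound_le hN' measureReal_nonneg measureReal_le_one h0 h1 hε
      le_rfl hKN hd
  · intro c hc
    have hη1 := SampleComplexity.Phi_pos (-(2 * c))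
    have hη2 := SampleComplexity.Phi_lt_one (2 * c)
    -- The gap between `Φ` on `[-2c, 2c]` and the values 0 and 1; half of it is spent on the
    -- approximation error.
    set η := min (SampleComplexity.Phi (-(2 * c))) (1 - SampleComplexity.Phi (2 * c)) with hη
    have hη0 : 0 < η := lt_min hη1 (sub_pos.2 hη2)
    obtain ⟨K, hK, h⟩ :=
      SampleComplexity.exists_forall_abs_measureReal_empProb_lt_sub_Phi_le.{v} (half_pos hη0)
    -- The factor 2 in `2 * K` pays for `p (1 - p)` being possibly only half of `δ (1 - δ)`.
    refine ⟨η / 2, max (4 * c ^ 2) (2 * K), half_pos hη0, by positivity, ?_⟩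
    intro N T Ω₀ Ω _ _ P₀ P _ _ X V hruns a δ t h0 h1 hKN hd
    have hN := SampleComplexity.natCast_pos_of_le_mul (by positivity) hKN
    have hN' : (0 : ℝ) < N := by exact_mod_cast hN
    set p := SampleComplexity.exceedProb P₀ (X t) a with hp
    obtain ⟨hvar, hx⟩ := SampleComplexity.window_bounds (p := p) hN' measureReal_nonneg measureReal_le_one
      h0 h1 hc ((le_max_left _ _).trans hKN) hd
    have hKp : K ≤ N * (p * (1 - p)) := by
      have h2K := (le_max_right (4 * c ^ 2) (2 * K)).trans hKN
      have := mul_le_mul_of_nonneg_left hvar hN'.le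
      linarith
    have happ := abs_le.1 (h N Ω P (fun i => V i t) (hruns.aemeasurable t) (hruns.indep t) a p
      (hruns.exceedProb_eq a t) hKp δ)
    have hlo := SampleComplexity.monotone_Phi (abs_le.1 hx).1
    have hhi := SampleComplexity.monotone_Phi (abs_le.1 hx).2
    have hm1 := min_le_left (SampleComplexity.Phi (-(2 * c))) (1 - SampleComplexity.Phi (2 * c))
    have hm2 := min_le_right (SampleComplexity.Phi (-(2 * c))) (1 - SampleComplexity.Phi (2 * c))
    rw [SampleComplexity.biasAt, SampleComplexity.integral_ind_empProb_lt (hruns.aemeasurable t)]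
    by_cases hpδ : p < δ
    · rw [SampleComplexity.ind_of_true hpδ, abs_sub_comm]
      refine le_trans ?_ (le_abs_self _)
      linarith [happ.2]
    · rw [SampleComplexity.ind_of_false hpδ, sub_zero]
      refine le_trans ?_ (le_abs_self _)
      linarith [happ.1]
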